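/- For a positive integer $n$ let $\sigma^{(1)}=\begin{pmatrix}0&1\\1&0\end{pmatrix}$ and $\sigma^{(3)}=\begin{pmatrix}1&0\\0&-1\end{pmatrix}$ be Pauli matrices, let $\sigma_j^{(a)}=I_2^{\otimes(j-1)}\otimes\sigma^{(a)}\otimes I_2^{\otimes(n-j)}$ for $1\le j\le n$ (a $2^n\times 2^n$ matrix acting on $(\mathbb{C}^2)^{\otimes n}$), with the cyclic convention $\sigma_{n+1}^{(a)}=\sigma_1^{(a)}$. Let $\alpha_1,\alpha_3\in\mathbb{R}$ be fixed and put $$H_n=\frac{1}{\sqrt n}\sum_{j=1}^n\left(\sigma_j^{(1)}\sigma_{j+1}^{(1)}+\alpha_1\sigma_j^{(1)}+\alpha_3\sigma_j^{(3)}\right).$$ Then for every positive integer $k$, $$\lim_{n\to\infty}\frac{1}{2^n}\operatorname{Tr}\left(H_n^{2k}\right)=\left(1+\alpha_1^2+\alpha_3^2\right)^{k}\,\frac{(2k)!}{2^k\,k!},$$ that is, the normalised even moments converge to the even moments of the centred Gaussian distribution with variance $1+\alpha_1^2+\alpha_3^2$. -/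

import Mathlib

/-- The matrices `σ⁽⁰⁾ = I₂` and the Pauli matrices `σ⁽¹⁾`, `σ⁽²⁾`, `σ⁽³⁾`. -/
def pauli : Fin 4 → Matrix (Fin 2) (Fin 2) ℂ
  | 0 => !![1, 0; 0, 1]
  | 1 => !![0, 1; 1, 0]
  | 2 => !![0, -Complex.I; Complex.I, 0]
  | 3 => !![1, 0; 0, -1]

/-- The matrix of `A₁ ⊗ ⋯ ⊗ Aₙ` on `(ℂ²)^{⊗ n}`, in the product basis `|x₁⟩ ⊗ ⋯ ⊗ |xₙ⟩`, which is
indexed by the functions `x : Fin n → Fin 2`. -/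
def tensorMatrix {n : ℕ} (A : Fin n → Matrix (Fin 2) (Fin 2) ℂ) :
    Matrix (Fin n → Fin 2) (Fin n → Fin 2) ℂ :=
  Matrix.of fun x y => ∏ i, A i (x i) (y i)

/-- `σ_j⁽ᵃ⁾ = I₂^{⊗ (j-1)} ⊗ σ⁽ᵃ⁾ ⊗ I₂^{⊗ (n-j)}`. The sites are labelled by `Fin n`, so the
site with one-based label `j` is the element of value `j - 1`. -/
def sitePauli {n : ℕ} (a : Fin 4) (j : Fin n) : Matrix (Fin n → Fin 2) (Fin n → Fin 2) ℂ :=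
  tensorMatrix (Function.update (fun _ => 1) j (pauli a))

/-- The Hamiltonian
`H_n = n^{-1/2} ∑_j (σ_j⁽¹⁾ σ_{j+1}⁽¹⁾ + α₁ σ_j⁽¹⁾ + α₃ σ_j⁽³⁾)` of a ring of `n` qubits;
`finRotate n j` is the cyclic successor of the site `j`. -/
noncomputable def isingHamiltonian (α₁ α₃ : ℝ) (n : ℕ) :
    Matrix (Fin n → Fin 2) (Fin n → Fin 2) ℂ :=
  ((1 / Real.sqrt n : ℝ) : ℂ) • ∑ j : Fin n,
    (sitePauli 1 j * sitePauli 1 (finRotate n j) +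
      (α₁ : ℂ) • sitePauli 1 j + (α₃ : ℂ) • sitePauli 3 j)

/-! Write `h_j` for `isingTerm α₁ α₃ j`. The power `H_n^(2k)` expands into `n^(-k)` times a sum over
`2k`-tuples of sites of ordered products of the `h_j`. The normalised trace acts as an expectation:
it factors over operators living on disjoint sets of sites. For `n ≥ 3` the `h_j` are centred,
pairwise uncorrelated, of variance `v = 1 + α₁² + α₃²`, and `h_j` touches only `j` and `j + 1`, so
they should behave like `n` independent Gaussians.

The comparison is made tuple by tuple with the Gaussian mixed moment `wickMoment`, whose sum over
all tuples is exactly `n^k` times the claimed limit (`sum_wickMoment_ofFn_even`). If some entry is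
near no other, both moments vanish; if every entry is near exactly one other, both factor over the
pairs (`normTrace_prod_eq_wickMoment_of_pairs`). The remaining, clustered tuples have fewer than `k`
connected clusters, so there are only `O(n^(k-1))` of them (`card_clusteredTuples_le`). Each
contributes a bounded error, and the total error is `O(1/n)`. -/

/-! ### Tensor products, the normalised trace and local operators -/

section TensorMatrix

variable {n : ℕ}

theorem tensorMatrix_mul (A B : Fin n → Matrix (Fin 2) (Fin 2) ℂ) :
    tensorMatrix A * tensorMatrix B = tensorMatrix (fun i => A i * B i) := by
  ext x y
  simp only [tensorMatrix, Matrix.mul_apply, Matrix.of_apply, ← Finset.prod_mul_distrib]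
  rw [Finset.prod_univ_sum, Fintype.piFinset_univ]

theorem tensorMatrix_one : tensorMatrix (fun _ : Fin n => 1) = 1 := by
  ext x y
  simp only [tensorMatrix, Matrix.of_apply, Matrix.one_apply]
  by_cases h : x = y
  · subst h; simp
  · obtain ⟨i, hi⟩ := Function.ne_iff.mp h
    rw [if_neg h]
    exact Finset.prod_eq_zero (Finset.mem_univ i) (by simp [hi])

theorem trace_tensorMatrix (A : Fin n → Matrix (Fin 2) (Fin 2) ℂ) :
    (tensorMatrix A).trace = ∏ i, (A i).trace := by
  simp only [tensorMatrix, Matrix.trace, Matrix.diag_apply, Matrix.of_apply]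
  rw [Finset.prod_univ_sum, Fintype.piFinset_univ]

/-- The trace on `(ℂ²)^{⊗ n}` normalised to take the value `1` at the identity. -/
noncomputable def normTrace (n : ℕ) :
    Matrix (Fin n → Fin 2) (Fin n → Fin 2) ℂ →ₗ[ℂ] ℂ :=
  (1 / 2 ^ n : ℂ) • Matrix.traceLinearMap (Fin n → Fin 2) ℂ ℂ

theorem normTrace_apply (A : Matrix (Fin n → Fin 2) (Fin n → Fin 2) ℂ) :
    normTrace n A = (1 / 2 ^ n : ℂ) * A.trace := rfl

theorem normTrace_mul_comm (A B : Matrix (Fin n → Fin 2) (Fin n → Fin 2) ℂ) :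
    normTrace n (A * B) = normTrace n (B * A) := by
  rw [normTrace_apply, normTrace_apply, Matrix.trace_mul_comm]

theorem normTrace_tensorMatrix (A : Fin n → Matrix (Fin 2) (Fin 2) ℂ) :
    normTrace n (tensorMatrix A) = ∏ i, (1 / 2 * (A i).trace) := by
  rw [normTrace_apply, trace_tensorMatrix, Finset.prod_mul_distrib]
  simp

theorem normTrace_one : normTrace n 1 = 1 := by
  rw [← tensorMatrix_one, normTrace_tensorMatrix]
  simp

/-- The operators that act as the identity on the sites outside `S`. -/
def localOn (S : Set (Fin n)) : Submodule ℂ (Matrix (Fin n → Fin 2) (Fin n → Fin 2) ℂ) :=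
  Submodule.span ℂ (tensorMatrix '' {A | ∀ i, i ∉ S → A i = 1})

theorem tensorMatrix_mem_localOn {S : Set (Fin n)} {A : Fin n → Matrix (Fin 2) (Fin 2) ℂ}
    (hA : ∀ i, i ∉ S → A i = 1) : tensorMatrix A ∈ localOn S :=
  Submodule.subset_span ⟨A, hA, rfl⟩

theorem localOn_mono {S T : Set (Fin n)} (h : S ⊆ T) : localOn S ≤ localOn T :=
  Submodule.span_mono (Set.image_mono fun _ hA i hi => hA i fun hS => hi (h hS))

theorem one_mem_localOn (S : Set (Fin n)) : 1 ∈ localOn S := by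
  rw [← tensorMatrix_one]
  exact tensorMatrix_mem_localOn fun _ _ => rfl

/-- Reduces properties that are linear in each argument to pure tensors, where they can be checked
site by site. -/
theorem localOn_induction₂ {S T : Set (Fin n)}
    {P : Matrix (Fin n → Fin 2) (Fin n → Fin 2) ℂ →
      Matrix (Fin n → Fin 2) (Fin n → Fin 2) ℂ → Prop}
    (tensor : ∀ A B, (∀ i, i ∉ S → A i = 1) → (∀ i, i ∉ T → B i = 1) →
      P (tensorMatrix A) (tensorMatrix B))
    (zero_left : ∀ b, P 0 b) (zero_right : ∀ a, P a 0)
    (add_left : ∀ a a' b, P a b → P a' b → P (a + a') b)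
    (add_right : ∀ a b b', P a b → P a b' → P a (b + b'))
    (smul_left : ∀ (c : ℂ) a b, P a b → P (c • a) b)
    (smul_right : ∀ (c : ℂ) a b, P a b → P a (c • b))
    {a b : Matrix (Fin n → Fin 2) (Fin n → Fin 2) ℂ}
    (ha : a ∈ localOn S) (hb : b ∈ localOn T) : P a b := by
  induction ha, hb using Submodule.span_induction₂ with
  | mem_mem x y hx hy =>
    obtain ⟨A, hA, rfl⟩ := hx
    obtain ⟨B, hB, rfl⟩ := hy
    exact tensor A B hA hB
  | zero_left y _ => exact zero_left y
  | zero_right x _ => exact zero_right x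
  | add_left x y z _ _ _ h1 h2 => exact add_left x y z h1 h2
  | add_right x y z _ _ _ h1 h2 => exact add_right x y z h1 h2
  | smul_left r x y _ _ h => exact smul_left r x y h
  | smul_right r x y _ _ h => exact smul_right r x y h

theorem mul_mem_localOn {S : Set (Fin n)} {a b : Matrix (Fin n → Fin 2) (Fin n → Fin 2) ℂ}
    (ha : a ∈ localOn S) (hb : b ∈ localOn S) : a * b ∈ localOn S := by
  refine localOn_induction₂ (P := fun a b => a * b ∈ localOn S) ?_ ?_ ?_ ?_ ?_ ?_ ?_ ha hb
  · intro A B hA hB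
    rw [tensorMatrix_mul]
    exact tensorMatrix_mem_localOn fun i hi => by rw [hA i hi, hB i hi, one_mul]
  · intro b; simp
  · intro a; simp
  · intro a a' b h h'; rw [add_mul]; exact add_mem h h'
  · intro a b b' h h'; rw [mul_add]; exact add_mem h h'
  · intro c a b h; rw [smul_mul_assoc]; exact Submodule.smul_mem _ _ h
  · intro c a b h; rw [mul_smul_comm]; exact Submodule.smul_mem _ _ h

theorem commute_of_mem_localOn {S T : Set (Fin n)} (hST : Disjoint S T)
    {a b : Matrix (Fin n → Fin 2) (Fin n → Fin 2) ℂ}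
    (ha : a ∈ localOn S) (hb : b ∈ localOn T) : Commute a b := by
  refine localOn_induction₂ (P := fun a b => Commute a b) ?_ (fun b => Commute.zero_left b)
    (fun a => Commute.zero_right a) (fun _ _ _ h h' => h.add_left h')
    (fun _ _ _ h h' => h.add_right h') (fun c _ _ h => h.smul_left c)
    (fun c _ _ h => h.smul_right c) ha hb
  intro A B hA hB
  rw [commute_iff_eq, tensorMatrix_mul, tensorMatrix_mul]
  congr 1
  funext i
  by_cases hi : i ∈ S
  · rw [hB i (Set.disjoint_left.mp hST hi), one_mul, mul_one]
  · rw [hA i hi, one_mul, mul_one]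

/-- The analogue of independence: at each site at least one of the two tensor factors is the
identity. -/
theorem normTrace_mul_of_mem_localOn {S T : Set (Fin n)} (hST : Disjoint S T)
    {a b : Matrix (Fin n → Fin 2) (Fin n → Fin 2) ℂ}
    (ha : a ∈ localOn S) (hb : b ∈ localOn T) :
    normTrace n (a * b) = normTrace n a * normTrace n b := by
  refine localOn_induction₂
    (P := fun a b => normTrace n (a * b) = normTrace n a * normTrace n b)
    ?_ ?_ ?_ ?_ ?_ ?_ ?_ ha hb
  · intro A B hA hB
    rw [tensorMatrix_mul]
    simp only [normTrace_tensorMatrix]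
    rw [← Finset.prod_mul_distrib]
    refine Finset.prod_congr rfl fun i _ => ?_
    by_cases hi : i ∈ S
    · simp [hB i (Set.disjoint_left.mp hST hi)]
    · simp [hA i hi]
  · intro b; simp
  · intro a; simp
  · intro a a' b h h'; rw [add_mul, map_add, map_add, h, h', add_mul]
  · intro a b b' h h'; rw [mul_add, map_add, map_add, h, h', mul_add]
  · intro c a b h; rw [smul_mul_assoc, map_smul, map_smul, h, smul_mul_assoc]
  · intro c a b h; rw [mul_smul_comm, map_smul, map_smul, h, mul_smul_comm]

theorem sitePauli_mem_localOn (a : Fin 4) (j : Fin n) : sitePauli a j ∈ localOn {j} :=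
  tensorMatrix_mem_localOn fun i hi => by
    rw [Function.update_of_ne (by simpa using hi)]

theorem sitePauli_mul_self (j : Fin n) (a b : Fin 4) :
    sitePauli a j * sitePauli b j =
      tensorMatrix (Function.update (fun _ => 1) j (pauli a * pauli b)) := by
  rw [sitePauli, sitePauli, tensorMatrix_mul]
  congr 1
  funext i
  by_cases hi : i = j
  · subst hi; simp
  · simp [hi]

theorem sitePauli_one_sq (j : Fin n) : sitePauli 1 j * sitePauli 1 j = 1 := by
  rw [sitePauli_mul_self, ← tensorMatrix_one]
  congr 1
  rw [Function.update_eq_self_iff]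
  ext i k
  fin_cases i <;> fin_cases k <;> simp [pauli]

theorem sitePauli_three_sq (j : Fin n) : sitePauli 3 j * sitePauli 3 j = 1 := by
  rw [sitePauli_mul_self, ← tensorMatrix_one]
  congr 1
  rw [Function.update_eq_self_iff]
  ext i k
  fin_cases i <;> fin_cases k <;> simp [pauli]

theorem normTrace_tensorMatrix_update (j : Fin n) (M : Matrix (Fin 2) (Fin 2) ℂ) :
    normTrace n (tensorMatrix (Function.update (fun _ => 1) j M)) = 1 / 2 * M.trace := by
  rw [normTrace_tensorMatrix, Finset.prod_eq_single j]
  · simp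
  · intro i _ hi; simp [hi]
  · simp

theorem normTrace_sitePauli_one (j : Fin n) : normTrace n (sitePauli 1 j) = 0 := by
  rw [sitePauli, normTrace_tensorMatrix_update]
  simp [pauli, Matrix.trace_fin_two]

theorem normTrace_sitePauli_three (j : Fin n) : normTrace n (sitePauli 3 j) = 0 := by
  rw [sitePauli, normTrace_tensorMatrix_update]
  simp [pauli, Matrix.trace_fin_two]

theorem normTrace_sitePauli_one_mul_three (j : Fin n) :
    normTrace n (sitePauli 1 j * sitePauli 3 j) = 0 := by
  rw [sitePauli_mul_self, normTrace_tensorMatrix_update]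
  simp [pauli, Matrix.trace_fin_two]

end TensorMatrix

/-! ### Mean, variance and covariance of the local terms -/

section IsingTerm

variable {n : ℕ}

/-- The summand of `√n H_n` that is attached to the site `j`. -/
noncomputable def isingTerm (α₁ α₃ : ℝ) (j : Fin n) :
    Matrix (Fin n → Fin 2) (Fin n → Fin 2) ℂ :=
  sitePauli 1 j * sitePauli 1 (finRotate n j) +
    (α₁ : ℂ) • sitePauli 1 j + (α₃ : ℂ) • sitePauli 3 j

/-- The field `σ⁽¹⁾_{j+1} + α₁` which multiplies `σ⁽¹⁾_j` in the summand of the site `j`. -/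
noncomputable def isingField (α₁ : ℝ) (j : Fin n) :
    Matrix (Fin n → Fin 2) (Fin n → Fin 2) ℂ :=
  sitePauli 1 (finRotate n j) + (α₁ : ℂ) • 1

theorem isingTerm_eq (α₁ α₃ : ℝ) (j : Fin n) :
    isingTerm α₁ α₃ j = sitePauli 1 j * isingField α₁ j + (α₃ : ℂ) • sitePauli 3 j := by
  simp [isingTerm, isingField, mul_add]

theorem isingField_mem_localOn (α₁ : ℝ) (j : Fin n) :
    isingField α₁ j ∈ localOn {finRotate n j} :=
  add_mem (sitePauli_mem_localOn _ _) (Submodule.smul_mem _ _ (one_mem_localOn _))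

theorem isingTerm_mem_localOn (α₁ α₃ : ℝ) (j : Fin n) :
    isingTerm α₁ α₃ j ∈ localOn {j, finRotate n j} := by
  have h (a : Fin 4) : sitePauli a j ∈ localOn {j, finRotate n j} :=
    localOn_mono (by simp) (sitePauli_mem_localOn a j)
  rw [isingTerm_eq]
  exact add_mem (mul_mem_localOn (h 1) (localOn_mono (by simp) (isingField_mem_localOn α₁ j)))
    (Submodule.smul_mem _ _ (h 3))

/-- Both summands of `isingTerm_eq` carry a traceless Pauli matrix at `j`, and nothing else in the
product acts there. -/
theorem normTrace_isingTerm_mul_of_mem_localOn (α₁ α₃ : ℝ) {j : Fin n}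
    (hj : finRotate n j ≠ j) {b : Matrix (Fin n → Fin 2) (Fin n → Fin 2) ℂ}
    (hb : b ∈ localOn {j}ᶜ) : normTrace n (isingTerm α₁ α₃ j * b) = 0 := by
  have hY : isingField α₁ j ∈ localOn {j}ᶜ :=
    localOn_mono (by simpa using hj.symm) (isingField_mem_localOn α₁ j)
  rw [isingTerm_eq, add_mul, map_add, mul_assoc, smul_mul_assoc, map_smul,
    normTrace_mul_of_mem_localOn disjoint_compl_right (sitePauli_mem_localOn 1 j)
      (mul_mem_localOn hY hb),
    normTrace_mul_of_mem_localOn disjoint_compl_right (sitePauli_mem_localOn 3 j) hb,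
    normTrace_sitePauli_one, normTrace_sitePauli_three]
  simp

theorem normTrace_isingTerm (α₁ α₃ : ℝ) {j : Fin n} (hj : finRotate n j ≠ j) :
    normTrace n (isingTerm α₁ α₃ j) = 0 := by
  simpa using normTrace_isingTerm_mul_of_mem_localOn α₁ α₃ hj (one_mem_localOn _)

/-- Adjacent terms overlap at `j + 1`, but the second one does not touch `j`, which is enough. -/
theorem normTrace_isingTerm_mul_finRotate (α₁ α₃ : ℝ) {j : Fin n} (hj : finRotate n j ≠ j)
    (hj' : finRotate n (finRotate n j) ≠ j) :
    normTrace n (isingTerm α₁ α₃ j * isingTerm α₁ α₃ (finRotate n j)) = 0 := by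
  refine normTrace_isingTerm_mul_of_mem_localOn α₁ α₃ hj
    (localOn_mono ?_ (isingTerm_mem_localOn α₁ α₃ _))
  rintro i (rfl | rfl)
  · exact hj
  · exact hj'

theorem normTrace_isingTerm_sq (α₁ α₃ : ℝ) {j : Fin n} (hj : finRotate n j ≠ j) :
    normTrace n (isingTerm α₁ α₃ j * isingTerm α₁ α₃ j) = 1 + (α₁ : ℂ) ^ 2 + (α₃ : ℂ) ^ 2 := by
  have hd : Disjoint ({j} : Set (Fin n)) {finRotate n j} := by simpa using hj.symm
  have hX := commute_of_mem_localOn hd (sitePauli_mem_localOn 1 j) (isingField_mem_localOn α₁ j)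
  have hZ := commute_of_mem_localOn hd (sitePauli_mem_localOn 3 j) (isingField_mem_localOn α₁ j)
  have hY : isingField α₁ j * isingField α₁ j =
      (1 + (α₁ : ℂ) ^ 2) • 1 + (2 * (α₁ : ℂ)) • sitePauli 1 (finRotate n j) := by
    simp only [isingField, mul_add, add_mul, sitePauli_one_sq, mul_smul_comm, smul_mul_assoc,
      mul_one, one_mul]
    module
  have h1 : sitePauli 1 j * isingField α₁ j * (sitePauli 1 j * isingField α₁ j) =
      isingField α₁ j * isingField α₁ j := by
    rw [mul_assoc, ← mul_assoc (isingField α₁ j), ← hX.eq, ← mul_assoc, ← mul_assoc,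
      sitePauli_one_sq, one_mul]
  have h2 : normTrace n (sitePauli 1 j * isingField α₁ j * sitePauli 3 j) = 0 := by
    rw [mul_assoc, ← hZ.eq, ← mul_assoc, normTrace_mul_of_mem_localOn hd
      (mul_mem_localOn (sitePauli_mem_localOn 1 j) (sitePauli_mem_localOn 3 j))
      (isingField_mem_localOn α₁ j), normTrace_sitePauli_one_mul_three, zero_mul]
  have h3 : normTrace n (sitePauli 3 j * (sitePauli 1 j * isingField α₁ j)) = 0 := by
    rw [normTrace_mul_comm, h2]
  rw [isingTerm_eq, add_mul, mul_add, mul_add, h1, hY]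
  simp only [mul_smul_comm, smul_mul_assoc, sitePauli_three_sq, map_add, map_smul, h2, h3,
    normTrace_one, normTrace_sitePauli_one, smul_eq_mul]
  ring

end IsingTerm

/-! ### Bounds on traces of products, uniform in `n` -/

section NormBound

attribute [local instance] Matrix.linftyOpNormedAddCommGroup Matrix.linftyOpNormedRing
  Matrix.linftyOpNormedAlgebra

theorem norm_entry_le_linfty_opNorm {m : Type*} [Fintype m] (A : Matrix m m ℂ) (i j : m) :
    ‖A i j‖ ≤ ‖A‖ := by
  rw [Matrix.linfty_opNorm_def, ← coe_nnnorm, NNReal.coe_le_coe]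
  exact (Finset.single_le_sum (f := fun k => ‖A i k‖₊) (fun _ _ => zero_le) (Finset.mem_univ j)).trans
    (Finset.le_sup (f := fun i => ∑ k, ‖A i k‖₊) (Finset.mem_univ i))

variable {n : ℕ}

theorem norm_normTrace_le (A : Matrix (Fin n → Fin 2) (Fin n → Fin 2) ℂ) :
    ‖normTrace n A‖ ≤ ‖A‖ := by
  rw [normTrace_apply, norm_mul, Matrix.trace]
  have h : ‖∑ i, A.diag i‖ ≤ 2 ^ n * ‖A‖ := by
    refine (norm_sum_le_of_le _ fun i _ => norm_entry_le_linfty_opNorm A i i).trans ?_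
    simp
  calc ‖(1 / 2 ^ n : ℂ)‖ * ‖∑ i, A.diag i‖ ≤ ‖(1 / 2 ^ n : ℂ)‖ * (2 ^ n * ‖A‖) := by gcongr
    _ = ‖A‖ := by simp

/-- The norm is the maximal absolute row sum; row sums multiply under tensor products, and each row
of a Pauli matrix has a single nonzero entry, of modulus one. -/
theorem norm_sitePauli_le (a : Fin 4) (j : Fin n) : ‖sitePauli a j‖ ≤ 1 := by
  have hrow (M : Matrix (Fin 2) (Fin 2) ℂ) (hM : M = 1 ∨ M = pauli a) (i : Fin 2) :
      ∑ k, ‖M i k‖₊ ≤ 1 := by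
    rcases hM with rfl | rfl
    · fin_cases i <;> simp [Matrix.one_apply]
    · fin_cases a <;> fin_cases i <;> simp [pauli]
  rw [Matrix.linfty_opNorm_def, ← NNReal.coe_one, NNReal.coe_le_coe]
  refine Finset.sup_le fun x _ => ?_
  let M : Fin n → Matrix (Fin 2) (Fin 2) ℂ := Function.update (fun _ => 1) j (pauli a)
  have h : ∑ y, ‖sitePauli a j x y‖₊ = ∏ i, ∑ k, ‖M i (x i) k‖₊ := by
    rw [Finset.prod_univ_sum, Fintype.piFinset_univ]
    exact Finset.sum_congr rfl fun y _ => by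
      rw [sitePauli, tensorMatrix, Matrix.of_apply, nnnorm_prod]
  rw [h]
  refine Finset.prod_le_one' fun i _ => hrow _ ?_ _
  by_cases hi : i = j
  · subst hi; simp [M]
  · simp [M, hi]

theorem norm_isingTerm_le (α₁ α₃ : ℝ) (j : Fin n) :
    ‖isingTerm α₁ α₃ j‖ ≤ 1 + |α₁| + |α₃| := by
  refine (norm_add₃_le).trans ?_
  gcongr
  · exact (norm_mul_le _ _).trans
      (mul_le_one₀ (norm_sitePauli_le _ _) (norm_nonneg _) (norm_sitePauli_le _ _))
  · rw [norm_smul, Complex.norm_real, Real.norm_eq_abs]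
    exact mul_le_of_le_one_right (abs_nonneg _) (norm_sitePauli_le _ _)
  · rw [norm_smul, Complex.norm_real, Real.norm_eq_abs]
    exact mul_le_of_le_one_right (abs_nonneg _) (norm_sitePauli_le _ _)

theorem norm_normTrace_prod_isingTerm_le (α₁ α₃ : ℝ) (L : List (Fin n)) :
    ‖normTrace n (L.map (isingTerm α₁ α₃)).prod‖ ≤ (1 + |α₁| + |α₃|) ^ L.length := by
  refine (norm_normTrace_le _).trans ?_
  induction L with
  | nil => simp [norm_one]
  | cons a L ih =>
    rw [List.map_cons, List.prod_cons, List.length_cons, pow_succ']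
    exact (norm_mul_le _ _).trans
      (mul_le_mul (norm_isingTerm_le α₁ α₃ a) ih (norm_nonneg _) (by positivity))

end NormBound

/-! ### Gaussian mixed moments by Wick's recursion -/

theorem eraseIdx_ofFn {V : Type*} {p : ℕ} (J : Fin (p + 1) → V) (i : Fin (p + 1)) :
    (List.ofFn J).eraseIdx i = List.ofFn (i.removeNth J) := by
  refine List.ext_getElem (by simp [List.length_eraseIdx]; omega) fun m h₁ h₂ => ?_
  have hm : m < p := by simpa using h₂
  rw [List.getElem_eraseIdx]
  simp only [List.getElem_ofFn, Fin.removeNth, Fin.succAbove, Fin.lt_def]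
  split_ifs <;> simp_all

section Wick

variable {V : Type*} [DecidableEq V]

/-- The mixed moment `𝔼[g_{a₁} ⋯ g_{aₚ}]` of independent centred Gaussian variables `g_a` of
variance `v`, evaluated by Wick's recursion. -/
def wickMoment (v : ℂ) : List V → ℂ
  | [] => 1
  | a :: L => ∑ i : Fin L.length, if L[i] = a then v * wickMoment v (L.eraseIdx i) else 0
termination_by L => L.length
decreasing_by simp [List.length_eraseIdx]

theorem wickMoment_nil (v : ℂ) : wickMoment v ([] : List V) = 1 := by
  rw [wickMoment]

theorem wickMoment_cons (v : ℂ) (a : V) (L : List V) :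
    wickMoment v (a :: L) =
      ∑ i : Fin L.length, if L[i] = a then v * wickMoment v (L.eraseIdx i) else 0 := by
  rw [wickMoment]

theorem wickMoment_cons_of_notMem (v : ℂ) {a : V} {L : List V} (h : a ∉ L) :
    wickMoment v (a :: L) = 0 := by
  rw [wickMoment_cons]
  refine Finset.sum_eq_zero fun i _ => if_neg ?_
  rintro rfl
  exact h (List.getElem_mem _)

/-- A lone `x` has no partner when it is the head; otherwise, removing a matched pair leaves it
alone in the shorter list. -/
theorem wickMoment_eq_zero_of_count_eq_one (v : ℂ) (x : V) :
    ∀ L : List V, L.count x = 1 → wickMoment v L = 0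
  | [], h => by simp at h
  | a :: L, h => by
    by_cases hax : a = x
    · subst hax
      exact wickMoment_cons_of_notMem v (List.count_eq_zero.mp (by simpa using h))
    · rw [wickMoment_cons]
      refine Finset.sum_eq_zero fun i _ => ?_
      split_ifs with hi
      · rw [wickMoment_eq_zero_of_count_eq_one v x (L.eraseIdx i), mul_zero]
        rw [← h, List.count_cons_of_ne hax]
        have := (List.getElem_cons_eraseIdx_perm (l := L) i.2).count_eq x
        rw [← this]
        exact (List.count_cons_of_ne (by simpa using hi ▸ hax)).symm
      · rfl
termination_by L => L.length
decreasing_by simp [List.length_eraseIdx]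

theorem wickMoment_cons_append_cons (v : ℂ) {a : V} {L₁ L₂ : List V} (h₁ : a ∉ L₁)
    (h₂ : a ∉ L₂) :
    wickMoment v (a :: (L₁ ++ a :: L₂)) = v * wickMoment v (L₁ ++ L₂) := by
  rw [wickMoment_cons, Finset.sum_eq_single ⟨L₁.length, by simp⟩]
  · simp [List.eraseIdx_append_of_length_le]
  · intro i _ hi
    refine if_neg fun hia => hi ?_
    ext
    rcases lt_trichotomy i.1 L₁.length with hlt | heq | hgt
    · have : (L₁ ++ a :: L₂)[i] = L₁[i.1] := List.getElem_append_left hlt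
      exact absurd (List.getElem_mem hlt) (by rw [← this, hia]; exact h₁)
    · exact heq
    · have hi2 := i.2
      simp only [List.length_append, List.length_cons] at hi2
      have : (L₁ ++ a :: L₂)[i] = L₂[i.1 - L₁.length - 1]'(by omega) := by
        simp only [Fin.getElem_fin]
        rw [List.getElem_append_right hgt.le, List.getElem_cons, dif_neg (by omega)]
      exact absurd (List.getElem_mem (l := L₂) (n := i.1 - L₁.length - 1) (by omega))
        (by rw [← this, hia]; exact h₂)
  · simp

theorem norm_wickMoment_le (v : ℂ) :
    ∀ L : List V, ‖wickMoment v L‖ ≤ L.length.factorial * (1 + ‖v‖) ^ L.length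
  | [] => by simp [wickMoment_nil]
  | a :: L => by
    rw [wickMoment_cons]
    have hb (i : Fin L.length) : ‖if L[i] = a then v * wickMoment v (L.eraseIdx i) else 0‖ ≤
        L.length.factorial * (1 + ‖v‖) ^ (L.length + 1) := by
      have hlen : (L.eraseIdx i).length ≤ L.length := by simp [List.length_eraseIdx]
      split_ifs
      · rw [norm_mul, pow_succ']
        have ih := norm_wickMoment_le v (L.eraseIdx i)
        have h1 : 1 ≤ 1 + ‖v‖ := le_add_of_nonneg_right (norm_nonneg v)
        calc ‖v‖ * ‖wickMoment v (L.eraseIdx i)‖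
            ≤ (1 + ‖v‖) * (L.length.factorial * (1 + ‖v‖) ^ L.length) := by
              refine mul_le_mul (by linarith) (ih.trans ?_) (norm_nonneg _) (by positivity)
              gcongr
          _ = _ := by ring
      · rw [norm_zero]; positivity
    refine (norm_sum_le_of_le _ fun i _ => hb i).trans ?_
    rw [Finset.sum_const, Finset.card_univ, Fintype.card_fin, nsmul_eq_mul, List.length_cons,
      Nat.factorial_succ, ← mul_assoc]
    push_cast
    gcongr
    linarith
termination_by L => L.length
decreasing_by simp [List.length_eraseIdx]

/-- The head has `p + 1` possible partner positions and the common value of the pair has `card V`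
choices; the other `p` entries stay free. -/
theorem sum_wickMoment_ofFn_succ_succ [Fintype V] (v : ℂ) (p : ℕ) :
    ∑ J : Fin (p + 2) → V, wickMoment v (List.ofFn J) =
      (p + 1) * Fintype.card V * v * ∑ J : Fin p → V, wickMoment v (List.ofFn J) := by
  have hstep (a : V) (J : Fin (p + 1) → V) :
      wickMoment v (List.ofFn (Fin.cons a J : Fin (p + 2) → V)) =
        ∑ i, if J i = a then v * wickMoment v (List.ofFn (i.removeNth J)) else 0 := by
    rw [List.ofFn_succ]
    simp only [Fin.cons_zero, Fin.cons_succ]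
    rw [wickMoment_cons]
    refine Fintype.sum_equiv (finCongr (by simp)) _ _ fun i => ?_
    rw [← eraseIdx_ofFn]
    simp [-List.ofFn_succ]
    rfl
  have hi (a : V) (i : Fin (p + 1)) :
      (∑ J : Fin (p + 1) → V, if J i = a then v * wickMoment v (List.ofFn (i.removeNth J)) else 0)
        = v * ∑ J : Fin p → V, wickMoment v (List.ofFn J) := by
    rw [← (Fin.insertNthEquiv (fun _ => V) i).sum_comp, Fintype.sum_prod_type]
    simp [Fin.insertNthEquiv, Finset.mul_sum]
  rw [← (Fin.consEquiv fun _ => V).sum_comp, Fintype.sum_prod_type]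
  simp only [Fin.consEquiv, Equiv.coe_fn_mk, hstep]
  simp_rw [Finset.sum_comm (t := (Finset.univ : Finset (Fin (p + 1)))), hi]
  simp
  ring

theorem sum_wickMoment_ofFn_even [Fintype V] (v : ℂ) (k : ℕ) :
    ∑ J : Fin (2 * k) → V, wickMoment v (List.ofFn J) =
      (Fintype.card V : ℂ) ^ k * (v ^ k * ((2 * k).factorial / (2 ^ k * k.factorial))) := by
  induction k with
  | zero => simp [wickMoment_nil]
  | succ k ih =>
    rw [show 2 * (k + 1) = 2 * k + 2 by ring, sum_wickMoment_ofFn_succ_succ, ih,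
      Nat.factorial_succ, Nat.factorial_succ, Nat.factorial_succ]
    have : (k.factorial : ℂ) ≠ 0 := by exact_mod_cast k.factorial_ne_zero
    have : (k : ℂ) + 1 ≠ 0 := by exact_mod_cast k.succ_ne_zero
    push_cast
    field_simp
    ring

end Wick

/-! ### Near sites: isolated entries and isolated pairs -/

section Near

variable {n : ℕ}

/-- Two sites of the ring are near if they are equal or adjacent. -/
def Near (a b : Fin n) : Prop :=
  b = a ∨ b = finRotate n a ∨ a = finRotate n b

instance (a : Fin n) : DecidablePred (Near a) := fun b => by
  unfold Near; infer_instance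

theorem Near.refl (a : Fin n) : Near a a := Or.inl rfl

theorem Near.symm {a b : Fin n} (h : Near a b) : Near b a := by
  rcases h with h | h | h
  · exact Or.inl h.symm
  · exact Or.inr (Or.inr h)
  · exact Or.inr (Or.inl h)

theorem disjoint_of_not_near {a b : Fin n} (h : ¬Near a b) :
    Disjoint ({a, finRotate n a} : Set (Fin n)) {b, finRotate n b} := by
  simp only [Near, not_or] at h
  have h' : finRotate n a ≠ finRotate n b := fun e => h.1 ((finRotate n).injective e).symm
  rw [Set.disjoint_left]
  rintro x (rfl | rfl) (h1 | h1)
  · exact h.1 h1.symm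
  · exact h.2.2 h1
  · exact h.2.1 h1.symm
  · exact h' h1

theorem prod_isingTerm_mem_localOn (α₁ α₃ : ℝ) {S : Set (Fin n)} (L : List (Fin n))
    (h : ∀ x ∈ L, {x, finRotate n x} ⊆ S) : (L.map (isingTerm α₁ α₃)).prod ∈ localOn S := by
  induction L with
  | nil => exact one_mem_localOn _
  | cons x L ih =>
    rw [List.map_cons, List.prod_cons]
    exact mul_mem_localOn (localOn_mono (h x (by simp)) (isingTerm_mem_localOn α₁ α₃ x))
      (ih fun y hy => h y (by simp [hy]))

theorem prod_isingTerm_mem_localOn_compl (α₁ α₃ : ℝ) (a : Fin n) (L : List (Fin n))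
    (h : ∀ x ∈ L, ¬Near a x) :
    (L.map (isingTerm α₁ α₃)).prod ∈ localOn {a, finRotate n a}ᶜ :=
  prod_isingTerm_mem_localOn α₁ α₃ L
    fun x hx => (disjoint_of_not_near (h x hx)).subset_compl_left

theorem finRotate_ne_self (hn : 3 ≤ n) (a : Fin n) : finRotate n a ≠ a := by
  obtain ⟨m, rfl⟩ : ∃ m, n = m + 3 := ⟨n - 3, by omega⟩
  rw [finRotate_apply]
  simp

theorem finRotate_finRotate_ne_self (hn : 3 ≤ n) (a : Fin n) :
    finRotate n (finRotate n a) ≠ a := by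
  obtain ⟨m, rfl⟩ : ∃ m, n = m + 3 := ⟨n - 3, by omega⟩
  rw [finRotate_apply, finRotate_apply, add_assoc, Ne, add_eq_left]
  simp only [Fin.ext_iff, Fin.val_add, Fin.val_one, Fin.val_zero]
  rw [Nat.mod_eq_of_lt (by omega)]
  omega

theorem normTrace_isingTerm_mul_of_ne (α₁ α₃ : ℝ) (hn : 3 ≤ n) {a b : Fin n} (hab : Near a b)
    (hne : a ≠ b) : normTrace n (isingTerm α₁ α₃ a * isingTerm α₁ α₃ b) = 0 := by
  rcases hab with h | h | h
  · exact absurd h.symm hne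
  · rw [h]
    exact normTrace_isingTerm_mul_finRotate α₁ α₃ (finRotate_ne_self hn a)
      (finRotate_finRotate_ne_self hn a)
  · rw [h, normTrace_mul_comm]
    exact normTrace_isingTerm_mul_finRotate α₁ α₃ (finRotate_ne_self hn b)
      (finRotate_finRotate_ne_self hn b)

theorem normTrace_prod_eq_wickMoment_of_isolated (α₁ α₃ : ℝ) (hn : 3 ≤ n) (L : List (Fin n))
    {x : Fin n} (hx : x ∈ L) (h : L.countP (Near x) = 1) :
    normTrace n (L.map (isingTerm α₁ α₃)).prod =
      wickMoment (1 + (α₁ : ℂ) ^ 2 + (α₃ : ℂ) ^ 2) L := by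
  have hc : L.count x = 1 := by
    refine le_antisymm ?_ (List.count_pos_iff.mpr hx)
    rw [← h, List.count]
    exact List.countP_mono_left fun y _ hy => by simpa [Near] using Or.inl (by simpa using hy)
  rw [wickMoment_eq_zero_of_count_eq_one _ x L hc]
  obtain ⟨L₁, L₂, rfl⟩ := List.append_of_mem hx
  have hfar : ∀ y ∈ L₂ ++ L₁, ¬Near x y := by
    rw [List.countP_append, List.countP_cons_of_pos (by simpa using Near.refl x)] at h
    have h0 : (L₂ ++ L₁).countP (Near x) = 0 := by rw [List.countP_append]; omega
    simpa [List.countP_eq_zero, -List.countP_append, -List.mem_append] using h0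
  have hmem := prod_isingTerm_mem_localOn_compl α₁ α₃ x _ hfar
  -- Cyclicity of the trace brings the isolated term to the front.
  rw [List.map_append, List.prod_append, normTrace_mul_comm, List.map_cons, List.prod_cons,
    mul_assoc, ← List.prod_append, ← List.map_append,
    normTrace_mul_of_mem_localOn disjoint_compl_right (isingTerm_mem_localOn α₁ α₃ x) hmem,
    normTrace_isingTerm α₁ α₃ (finRotate_ne_self hn x), zero_mul]

theorem commute_isingTerm_prod (α₁ α₃ : ℝ) (a : Fin n) (L : List (Fin n))
    (h : ∀ x ∈ L, ¬Near a x) :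
    Commute (isingTerm α₁ α₃ a) (L.map (isingTerm α₁ α₃)).prod :=
  commute_of_mem_localOn disjoint_compl_right (isingTerm_mem_localOn α₁ α₃ a)
    (prod_isingTerm_mem_localOn_compl α₁ α₃ a L h)

theorem normTrace_pair_mul_prod (α₁ α₃ : ℝ) (a b : Fin n) (L : List (Fin n))
    (ha : ∀ x ∈ L, ¬Near a x) (hb : ∀ x ∈ L, ¬Near b x) :
    normTrace n (isingTerm α₁ α₃ a * isingTerm α₁ α₃ b * (L.map (isingTerm α₁ α₃)).prod) =
      normTrace n (isingTerm α₁ α₃ a * isingTerm α₁ α₃ b) *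
        normTrace n (L.map (isingTerm α₁ α₃)).prod := by
  let S : Set (Fin n) := {a, finRotate n a} ∪ {b, finRotate n b}
  have hS : (L.map (isingTerm α₁ α₃)).prod ∈ localOn Sᶜ :=
    prod_isingTerm_mem_localOn α₁ α₃ L fun x hx => by
      rw [Set.compl_union]
      exact Set.subset_inter (disjoint_of_not_near (ha x hx)).subset_compl_left
        (disjoint_of_not_near (hb x hx)).subset_compl_left
  exact normTrace_mul_of_mem_localOn (S := S) disjoint_compl_right
    (mul_mem_localOn (localOn_mono Set.subset_union_left (isingTerm_mem_localOn α₁ α₃ a))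
      (localOn_mono Set.subset_union_right (isingTerm_mem_localOn α₁ α₃ b))) hS

/-- The count `2` includes the entry itself, so the head `a` has a unique near partner `b`. All
other entries are far from both: `b` commutes up to `a`, the pair splits off, and the hypothesis
passes to the rest. The pair gives `v` if `a = b` and `0` otherwise, as in Wick's recursion. -/
theorem normTrace_prod_eq_wickMoment_of_pairs (α₁ α₃ : ℝ) (hn : 3 ≤ n) :
    ∀ L : List (Fin n), (∀ x ∈ L, L.countP (Near x) = 2) →
      normTrace n (L.map (isingTerm α₁ α₃)).prod =
        wickMoment (1 + (α₁ : ℂ) ^ 2 + (α₃ : ℂ) ^ 2) L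
  | [], _ => by simp [normTrace_one, wickMoment_nil]
  | a :: L, h => by
    have ha : L.countP (Near a) = 1 := by
      have := h a (by simp)
      rw [List.countP_cons_of_pos (by simpa using Near.refl a)] at this
      omega
    obtain ⟨b, hbL, hab⟩ : ∃ b ∈ L, Near a b := by
      have : 0 < L.countP (Near a) := by omega
      simpa [List.countP_pos_iff] using this
    obtain ⟨L₁, L₂, rfl⟩ := List.append_of_mem hbL
    have hfa : ∀ y ∈ L₁ ++ L₂, ¬Near a y := by
      rw [List.countP_append, List.countP_cons_of_pos (by simpa using hab)] at ha
      have h0 : (L₁ ++ L₂).countP (Near a) = 0 := by rw [List.countP_append]; omega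
      simpa [List.countP_eq_zero, -List.countP_append, -List.mem_append] using h0
    have hfb : ∀ y ∈ L₁ ++ L₂, ¬Near b y := by
      have hb := h b (by simp)
      rw [List.countP_cons_of_pos (by simpa using hab.symm), List.countP_append,
        List.countP_cons_of_pos (by simpa using Near.refl b)] at hb
      have h0 : (L₁ ++ L₂).countP (Near b) = 0 := by rw [List.countP_append]; omega
      simpa [List.countP_eq_zero, -List.countP_append, -List.mem_append] using h0
    have ih := normTrace_prod_eq_wickMoment_of_pairs α₁ α₃ hn (L₁ ++ L₂) fun x hx => by
      have hxa : ¬Near x a := fun e => hfa x hx e.symm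
      have hxb : ¬Near x b := fun e => hfb x hx e.symm
      have hx' := h x (by simp only [List.mem_append, List.mem_cons] at hx ⊢; tauto)
      rwa [List.countP_cons_of_neg (by simpa using hxa), List.countP_append,
        List.countP_cons_of_neg (by simpa using hxb), ← List.countP_append] at hx'
    have hcomm := commute_isingTerm_prod α₁ α₃ b L₁
      fun x hx => hfb x (List.mem_append_left _ hx)
    have hprod : ((a :: (L₁ ++ b :: L₂)).map (isingTerm α₁ α₃)).prod =
        isingTerm α₁ α₃ a * isingTerm α₁ α₃ b * ((L₁ ++ L₂).map (isingTerm α₁ α₃)).prod := by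
      simp only [List.map_cons, List.map_append, List.prod_cons, List.prod_append]
      rw [← mul_assoc _ (isingTerm α₁ α₃ b), ← hcomm.eq]
      simp only [mul_assoc]
    rw [hprod, normTrace_pair_mul_prod α₁ α₃ a b _ hfa hfb, ih]
    by_cases hne : a = b
    · subst hne
      rw [normTrace_isingTerm_sq α₁ α₃ (finRotate_ne_self hn a), wickMoment_cons_append_cons]
      · exact fun e => hfa a (List.mem_append_left _ e) (Near.refl a)
      · exact fun e => hfa a (List.mem_append_right _ e) (Near.refl a)
    · rw [normTrace_isingTerm_mul_of_ne α₁ α₃ hn hab hne, zero_mul, wickMoment_cons_of_notMem]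
      intro e
      rcases List.mem_append.mp e with e | e
      · exact hfa a (List.mem_append_left _ e) (Near.refl a)
      · rcases List.mem_cons.mp e with e | e
        · exact hne e
        · exact hfa a (List.mem_append_right _ e) (Near.refl a)
termination_by L => L.length
decreasing_by simp_all

end Near

/-! ### Counting the clustered tuples -/

section Clusters

open Finset

theorem two_mul_card_lt_of_fibers {ι κ : Type*} [Fintype ι] [Fintype κ] [DecidableEq κ]
    (f : ι → κ) (h : ∀ c, 2 ≤ #{i | f i = c}) (h' : ∃ c, 3 ≤ #{i | f i = c}) :
    2 * Fintype.card κ < Fintype.card ι := by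
  obtain ⟨c, hc⟩ := h'
  have hsum : Fintype.card ι = ∑ c, #{i | f i = c} :=
    card_eq_sum_card_fiberwise (f := f) (s := univ) (t := univ) (by simp)
  have hlt : ∑ _c : κ, 2 < ∑ c, #{i | f i = c} :=
    sum_lt_sum (fun c _ => h c) ⟨c, mem_univ c, hc⟩
  rw [hsum]
  simpa [mul_comm] using hlt

theorem countP_ofFn_eq_card {V : Type*} {p : ℕ} (J : Fin p → V) (q : V → Prop) [DecidablePred q] :
    (List.ofFn J).countP q = #{i | q (J i)} := by
  rw [List.ofFn_eq_map, List.countP_map, List.countP_eq_length_filter]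
  rfl

variable {n p : ℕ}

/-- The graph on the positions of a tuple of sites that joins positions with near sites. -/
def nearGraph (J : Fin p → Fin n) : SimpleGraph (Fin p) where
  Adj i j := i ≠ j ∧ Near (J i) (J j)
  symm := ⟨fun _ _ h => ⟨h.1.symm, h.2.symm⟩⟩
  loopless := ⟨fun _ h => h.1 rfl⟩

theorem exists_shift_of_walk (J : Fin p → Fin n) {i j : Fin p} (w : (nearGraph J).Walk i j) :
    ∃ m : ℤ, |m| ≤ w.length ∧ J j = (finRotate n ^ m) (J i) := by
  induction w with
  | nil => exact ⟨0, by simp⟩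
  | @cons a b c hab w ih =>
    obtain ⟨m, hm, hJ⟩ := ih
    obtain ⟨d, hd, hJ'⟩ : ∃ d : ℤ, |d| ≤ 1 ∧ J b = (finRotate n ^ d) (J a) := by
      rcases hab.2 with h | h | h
      · exact ⟨0, by simp [h]⟩
      · exact ⟨1, by simp [h]⟩
      · exact ⟨-1, by simp, by
          rw [h, zpow_neg_one]
          exact (Equiv.symm_apply_apply (finRotate n) (J b)).symm⟩
    refine ⟨m + d, (abs_add_le m d).trans ?_, ?_⟩
    · rw [SimpleGraph.Walk.length_cons]; push_cast; linarith
    · rw [hJ, hJ', zpow_add, Equiv.Perm.mul_apply]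

/-- The tuples of sites in which every entry is near to another one and some entry is near to at
least two others. -/
def clusteredTuples (n p : ℕ) : Finset (Fin p → Fin n) :=
  {J | (∀ i, 2 ≤ #{j | Near (J i) (J j)}) ∧ ∃ i, 3 ≤ #{j | Near (J i) (J j)}}

/-- The positions near a given one lie in its component, so every component has at least two
positions and some component has at least three. -/
theorem card_connectedComponent_nearGraph_lt {J : Fin p → Fin n}
    [Fintype (nearGraph J).ConnectedComponent] (hJ : J ∈ clusteredTuples n p) :
    2 * Fintype.card (nearGraph J).ConnectedComponent < p := by
  classical
  simp only [clusteredTuples, mem_filter, mem_univ, true_and] at hJ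
  have hsub (i : Fin p) : (({j | Near (J i) (J j)} : Finset (Fin p))) ⊆
      ({j | (nearGraph J).connectedComponentMk j = (nearGraph J).connectedComponentMk i} :
        Finset (Fin p)) := by
    intro j hj
    simp only [mem_filter, mem_univ, true_and] at hj ⊢
    by_cases hij : i = j
    · rw [hij]
    · have hadj : (nearGraph J).Adj i j := ⟨hij, hj⟩
      exact (SimpleGraph.ConnectedComponent.connectedComponentMk_eq_of_adj hadj).symm
  have h := two_mul_card_lt_of_fibers (nearGraph J).connectedComponentMk
    (fun c => by
      induction c using SimpleGraph.ConnectedComponent.ind with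
      | _ i => exact (hJ.1 i).trans (card_le_card (hsub i)))
    (by
      obtain ⟨i, hi⟩ := hJ.2
      exact ⟨(nearGraph J).connectedComponentMk i, hi.trans (card_le_card (hsub i))⟩)
  simpa using h

/-- A clustered tuple is encoded by a component label for each position, a displacement in `[-2k,
2k]` from the component's representative, and the sites of the representatives. Only the last datum
depends on `n`. -/
theorem card_clusteredTuples_le (n k : ℕ) :
    #(clusteredTuples n (2 * k)) ≤
      (k - 1) ^ (2 * k) * (4 * k + 1) ^ (2 * k) * n ^ (k - 1) := by
  classical
  let D := Finset.Icc (-(2 * k : ℤ)) (2 * k)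
  let F : (Fin (2 * k) → Fin (k - 1)) × (Fin (2 * k) → D) × (Fin (k - 1) → Fin n) →
      (Fin (2 * k) → Fin n) :=
    fun t i => (finRotate n ^ (t.2.1 i : ℤ)) (t.2.2 (t.1 i))
  have hsub : clusteredTuples n (2 * k) ⊆ univ.image F := by
    intro J hJ
    have hcard := card_connectedComponent_nearGraph_lt hJ
    obtain ⟨e⟩ : Nonempty ((nearGraph J).ConnectedComponent ↪ Fin (k - 1)) :=
      Function.Embedding.nonempty_of_card_le (by rw [Fintype.card_fin]; omega)
    have hne : Nonempty (Fin (2 * k)) := by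
      simp only [clusteredTuples, mem_filter] at hJ
      exact ⟨hJ.2.2.choose⟩
    have : Nonempty (Fin n) := hne.map J
    choose r hr using fun c : (nearGraph J).ConnectedComponent => c.exists_rep
    have hz (i : Fin (2 * k)) : ∃ m : ℤ, m ∈ D ∧
        J i = (finRotate n ^ m) (J (r ((nearGraph J).connectedComponentMk i))) := by
      have hreach : (nearGraph J).Reachable (r ((nearGraph J).connectedComponentMk i)) i :=
        SimpleGraph.ConnectedComponent.exact (hr _)
      obtain ⟨w, hw⟩ := hreach.exists_isPath
      obtain ⟨m, hm, hJm⟩ := exists_shift_of_walk J w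
      have hlt := hw.length_lt
      rw [Fintype.card_fin] at hlt
      refine ⟨m, ?_, hJm⟩
      rw [Finset.mem_Icc, ← abs_le]
      exact hm.trans (by exact_mod_cast hlt.le)
    choose z hzD hzJ using hz
    -- Labels outside the range of `e` receive an arbitrary site, which is never read.
    refine mem_image.mpr ⟨⟨fun i => e ((nearGraph J).connectedComponentMk i),
      fun i => ⟨z i, hzD i⟩, Function.extend e (fun c => J (r c)) (fun _ => Classical.arbitrary _)⟩,
      mem_univ _, ?_⟩
    funext i
    simp only [F]
    rw [e.injective.extend_apply, ← hzJ i]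
  refine (card_le_card hsub).trans (card_image_le.trans ?_)
  have hD : Fintype.card D = 4 * k + 1 := by
    simp only [D, Fintype.card_coe, Int.card_Icc]
    omega
  rw [card_univ, Fintype.card_prod, Fintype.card_prod]
  simp only [Fintype.card_fun, Fintype.card_fin, hD]
  rw [mul_assoc]

end Clusters

/-! ### Comparison of the moments and passage to the limit -/

section Limit

open Finset

variable {n : ℕ}

theorem normTrace_prod_eq_wickMoment_of_not_clustered (α₁ α₃ : ℝ) (hn : 3 ≤ n) {p : ℕ}
    {J : Fin p → Fin n} (hJ : J ∉ clusteredTuples n p) :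
    normTrace n ((List.ofFn J).map (isingTerm α₁ α₃)).prod =
      wickMoment (1 + (α₁ : ℂ) ^ 2 + (α₃ : ℂ) ^ 2) (List.ofFn J) := by
  simp only [clusteredTuples, mem_filter, mem_univ, true_and, not_and_or, not_forall,
    not_exists, not_le] at hJ
  have hpos (i : Fin p) : 1 ≤ #{j | Near (J i) (J j)} :=
    card_pos.mpr ⟨i, by simpa using Near.refl (J i)⟩
  by_cases h : ∃ i, #{j | Near (J i) (J j)} < 2
  · obtain ⟨i, hi⟩ := h
    refine normTrace_prod_eq_wickMoment_of_isolated α₁ α₃ hn _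
      (List.mem_ofFn.mpr ⟨i, rfl⟩) ?_
    rw [countP_ofFn_eq_card]
    have := hpos i
    omega
  · have h3 := hJ.resolve_left h
    refine normTrace_prod_eq_wickMoment_of_pairs α₁ α₃ hn _ fun x hx => ?_
    obtain ⟨i, rfl⟩ := List.mem_ofFn.mp hx
    rw [countP_ofFn_eq_card]
    have := h3 i
    have : ¬#{j | Near (J i) (J j)} < 2 := fun e => h ⟨i, e⟩
    omega

theorem sum_pow_eq_sum_prod_ofFn {R ι : Type*} [Semiring R] [Fintype ι] (f : ι → R) (p : ℕ) :
    (∑ i, f i) ^ p = ∑ J : Fin p → ι, ((List.ofFn J).map f).prod := by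
  induction p with
  | zero => simp
  | succ p ih =>
    rw [pow_succ', ih, ← (Fin.consEquiv fun _ => ι).sum_comp, Fintype.sum_prod_type, sum_mul_sum]
    simp [Fin.consEquiv, List.ofFn_succ]

theorem normTrace_isingHamiltonian_pow (α₁ α₃ : ℝ) (k : ℕ) :
    normTrace n (isingHamiltonian α₁ α₃ n ^ (2 * k)) =
      (1 / (n : ℂ) ^ k) * ∑ J : Fin (2 * k) → Fin n,
        normTrace n ((List.ofFn J).map (isingTerm α₁ α₃)).prod := by
  have hH : isingHamiltonian α₁ α₃ n =
      ((1 / Real.sqrt n : ℝ) : ℂ) • ∑ j, isingTerm α₁ α₃ j := rfl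
  have hc : ((1 / Real.sqrt n : ℝ) : ℂ) ^ (2 * k) = 1 / (n : ℂ) ^ k := by
    rw [pow_mul, ← Complex.ofReal_pow, div_pow, Real.sq_sqrt (Nat.cast_nonneg n)]
    simp
  rw [hH, smul_pow, hc, sum_pow_eq_sum_prod_ofFn, map_smul, map_sum, smul_eq_mul]

theorem norm_normTrace_isingHamiltonian_pow_sub_le (α₁ α₃ : ℝ) {k : ℕ} (hk : 0 < k) :
    ∃ C : ℝ, ∀ n : ℕ, 3 ≤ n →
      ‖normTrace n (isingHamiltonian α₁ α₃ n ^ (2 * k)) -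
        (1 + (α₁ : ℂ) ^ 2 + (α₃ : ℂ) ^ 2) ^ k * ((2 * k).factorial / (2 ^ k * k.factorial))‖ ≤
        C / n := by
  set v : ℂ := 1 + (α₁ : ℂ) ^ 2 + (α₃ : ℂ) ^ 2
  set B : ℝ := (1 + |α₁| + |α₃|) ^ (2 * k) + (2 * k).factorial * (1 + ‖v‖) ^ (2 * k)
  have hB0 : 0 ≤ B := by positivity
  set N : ℕ := (k - 1) ^ (2 * k) * (4 * k + 1) ^ (2 * k)
  refine ⟨N * B, fun n hn => ?_⟩
  have hn0 : (n : ℂ) ≠ 0 := by exact_mod_cast (by omega : n ≠ 0)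
  have hn0' : (n : ℝ) ≠ 0 := by exact_mod_cast (by omega : n ≠ 0)
  -- The Gaussian side is exact at each such `n`, so the whole error comes from the clustered
  -- tuples.
  have hG : v ^ k * ((2 * k).factorial / (2 ^ k * k.factorial)) =
      (1 / (n : ℂ) ^ k) * ∑ J : Fin (2 * k) → Fin n, wickMoment v (List.ofFn J) := by
    rw [sum_wickMoment_ofFn_even, Fintype.card_fin, ← mul_assoc, one_div,
      inv_mul_cancel₀ (pow_ne_zero k hn0), one_mul]
  rw [normTrace_isingHamiltonian_pow, hG, ← mul_sub, ← sum_sub_distrib,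
    ← sum_subset (subset_univ (clusteredTuples n (2 * k))) fun J _ hJ => by
      rw [normTrace_prod_eq_wickMoment_of_not_clustered α₁ α₃ hn hJ, sub_self], norm_mul]
  have hterm : ∀ J ∈ clusteredTuples n (2 * k),
      ‖normTrace n ((List.ofFn J).map (isingTerm α₁ α₃)).prod - wickMoment v (List.ofFn J)‖ ≤
        B := fun J _ => by
    refine (norm_sub_le _ _).trans (add_le_add ?_ ?_)
    · simpa using norm_normTrace_prod_isingTerm_le α₁ α₃ (List.ofFn J)
    · simpa using norm_wickMoment_le v (List.ofFn J)
  have hcard : (#(clusteredTuples n (2 * k)) : ℝ) ≤ N * (n : ℝ) ^ (k - 1) := by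
    exact_mod_cast card_clusteredTuples_le n k
  calc _ ≤ ‖(1 / (n : ℂ) ^ k)‖ * (N * (n : ℝ) ^ (k - 1) * B) := by
        gcongr
        refine (norm_sum_le_of_le _ hterm).trans ?_
        rw [sum_const, nsmul_eq_mul]
        gcongr
    -- Here `k > 0` matters: only then is the truncated `k - 1` a genuine drop in the power of `n`.
    _ = N * B / n := by
        obtain ⟨m, rfl⟩ : ∃ m, k = m + 1 := ⟨k - 1, by omega⟩
        simp only [one_div, norm_inv, norm_pow, Complex.norm_natCast, Nat.add_sub_cancel]
        field_simp
        ring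

end Limit

theorem mainTheorem7 (α₁ α₃ : ℝ) (k : ℕ) (hk : 0 < k) :
    Filter.Tendsto
      (fun n : ℕ => (1 / 2 ^ n : ℂ) * Matrix.trace (isingHamiltonian α₁ α₃ n ^ (2 * k)))
      Filter.atTop
      (nhds (((1 + α₁ ^ 2 + α₃ ^ 2) ^ k *
        ((Nat.factorial (2 * k) : ℝ) / (2 ^ k * (Nat.factorial k : ℝ))) : ℝ) : ℂ)) := by
  obtain ⟨C, hC⟩ := norm_normTrace_isingHamiltonian_pow_sub_le α₁ α₃ hk
  rw [tendsto_iff_norm_sub_tendsto_zero]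
  refine squeeze_zero' (Filter.Eventually.of_forall fun _ => norm_nonneg _) ?_
    (tendsto_const_div_atTop_nhds_zero_nat C)
  filter_upwards [Filter.eventually_ge_atTop 3] with n hn
  push_cast
  exact hC n hn
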